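/- Let $T>0$, $k\in\mathbb{N}$, and let $(\Omega,\mathscr F,\mathbb P_0)$ be a probability space carrying $\mathbb{Z}_{\ge 0}$-valued random variables $N_t(i)$, $1\le i\le k$, $t\in[0,T]$; put $N_t=(N_t(1),\dots,N_t(k))$ and $\mathscr F^N_t=\sigma(N_s:0\le s\le t)$. Let $\beta_i,\nu_i:[0,T]\to\mathbb{R}$ be continuous functions with values in $[\beta_{\min},\beta_{\max}]$ and $[\nu_{\min},\nu_{\max}]$ respectively, where the constants $0<\beta_{\min}<\beta_{\max}<\infty$ and $0<\nu_{\min}<\nu_{\max}<\infty$ do not depend on $i$. For a probability measure $\mathbb P$ on $(\Omega,\mathscr F)$ and a nonnegative, measurable, integrable $\lambda:[0,T]\to\mathbb{R}$, the process $N_t(i)$ is called an $\mathscr F^N_t$-Poisson process over $[0,T]$ with intensity $\lambda$ under $\mathbb P$ if it is a counting process (each path starts at $0$, is non-decreasing, right-continuous and piecewise constant, and increases in steps of size $1$) and, for all $0\le s\le t\le T$, the increment $N_t(i)-N_s(i)$ is independent of $\mathscr F^N_s$ under $\mathbb P$ and is Poisson distributed with parameter $\int_s^t\lambda(u)\,du$.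 Suppose that under $\mathbb P_0$ the processes $(N_t(i))_{t\in[0,T]}$, $1\le i\le k$, are mutually independent $\mathscr F^N_t$-Poisson processes over $[0,T]$ with intensities $\beta_i$. Let $\tau_n(i)$ denote the $n$-th jump time of $N_t(i)$, and let $$L_T=\prod_{i=1}^k L_T(i),\qquad L_T(i)=\exp\Big(-\int_0^T\nu_i(s)\,ds\Big)\prod_{n=1}^{N_T(i)}\Big(1+\frac{\nu_i(\tau_n(i))}{\beta_i(\tau_n(i))}\Big).$$ Then $L_T$ is a random variable, and $\mathbb P_1(A)=\int_A L_T\,d\mathbb P_0$, $A\in\mathscr F$, defines a probability measure $\mathbb P_1$ on $(\Omega,\mathscr F)$ with $\mathbb P_1\ll\mathbb P_0$, under which the processes $(N_t(i))_{t\in[0,T]}$, $1\le i\le k$, are mutually independent $\mathscr F^N_t$-Poisson processes over $[0,T]$ with intensities $\beta_i+\nu_i$. -/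

import Mathlib

open MeasureTheory ProbabilityTheory

namespace PoissonDetection

/-- The path `x` is the path of a counting process over the time horizon `[0, T]`: it starts at `0`,
is non-decreasing, right-continuous (hence, being `ℕ`-valued, piecewise constant), and increases in
steps of size `1`. Values of `x` outside `[0, T]` play no role. -/
structure IsCountingPath (T : ℝ) (x : ℝ → ℕ) : Prop where
  zero : x 0 = 0
  mono : MonotoneOn x (Set.Icc 0 T)
  rightCont : ∀ t ∈ Set.Icc 0 T, ContinuousWithinAt x (Set.Icc t T) t
  -- For times `s < t` close to `t`, `x s` is the left limit of `x` at `t`.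
  unitJump : ∀ t ∈ Set.Ioc 0 T, ∀ᶠ s in nhdsWithin t (Set.Iio t), x t ≤ x s + 1

/-- The `n`-th jump time `τ_n` (`n ≥ 1`) of the counting path `x` over `[0, T]`, i.e. the first time
at which `n` counts have been registered. Only meaningful (and only used) for `n ≤ x T`. -/
noncomputable def jumpTime (T : ℝ) (x : ℝ → ℕ) (n : ℕ) : ℝ :=
  sInf {t | t ∈ Set.Icc 0 T ∧ n ≤ x t}

/-- The filtration `ℱ^N_t = σ(N_s : 0 ≤ s ≤ t)`, `t ∈ [0, T]`, generated by the vector of processes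
`N_t = (N_t(1), …, N_t(k))`. -/
noncomputable def history {Ω : Type*} [mΩ : MeasurableSpace Ω] {k : ℕ} {T : ℝ}
    (N : Fin k → ℝ → Ω → ℕ) (hN : ∀ i, ∀ t : Set.Icc (0 : ℝ) T, Measurable (N i t)) :
    Filtration (Set.Icc (0 : ℝ) T) mΩ :=
  Filtration.natural (fun (t : Set.Icc (0 : ℝ) T) ω (i : Fin k) => N i t ω)
    (fun t => (measurable_pi_lambda _ (fun i => hN i t)).stronglyMeasurable)

/-- `N` is a `(P, ℱ_t)`-Poisson process over `[0, T]` with (deterministic, time-dependent)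
intensity `r`. The truncated difference `N t ω - N s ω` is the true one since paths are
non-decreasing. -/
structure IsPoissonProcess {Ω : Type*} [mΩ : MeasurableSpace Ω] {T : ℝ} (P : Measure Ω)
    (ℱ : Filtration (Set.Icc (0 : ℝ) T) mΩ) (N : ℝ → Ω → ℕ) (r : ℝ → ℝ) : Prop where
  intensity_nonneg : ∀ t ∈ Set.Icc 0 T, 0 ≤ r t
  intensity_measurable : Measurable (fun t : Set.Icc (0 : ℝ) T => r t)
  intensity_integrable : IntegrableOn r (Set.Icc 0 T)
  counting : ∀ ω, IsCountingPath T (fun t => N t ω)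
  adapted : ∀ t : Set.Icc (0 : ℝ) T, Measurable[ℱ t] (N t)
  indep : ∀ s t : Set.Icc (0 : ℝ) T, s ≤ t →
    Indep (MeasurableSpace.comap (fun ω => N t ω - N s ω) ⊤) (ℱ s) P
  law : ∀ s t : Set.Icc (0 : ℝ) T, s ≤ t →
    HasLaw (fun ω => N t ω - N s ω) (poissonMeasure (∫ u in (s : ℝ)..t, r u).toNNReal) P

/-- Under `P`, the components `N_t(i)`, `t ∈ [0, T]`, are (mutually) independent processes and each
of them is an `ℱ^N_t`-Poisson process, with intensity `r i`. -/
structure AreIndepPoisson {Ω : Type*} [MeasurableSpace Ω] {k : ℕ} {T : ℝ} (P : Measure Ω)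
    (N : Fin k → ℝ → Ω → ℕ) (hN : ∀ i, ∀ t : Set.Icc (0 : ℝ) T, Measurable (N i t))
    (r : Fin k → ℝ → ℝ) : Prop where
  poisson : ∀ i, IsPoissonProcess P (history N hN) (N i) (r i)
  indep : iIndepFun (fun i ω (t : Set.Icc (0 : ℝ) T) => N i t ω) P

/-- The functions `f i` are continuous on `[0, T]` with values in a common interval `[m, M]`,
`0 < m < M < ∞`. -/
def IsAdmissible {k : ℕ} (T : ℝ) (f : Fin k → ℝ → ℝ) : Prop :=
  ∃ m M : ℝ, 0 < m ∧ m < M ∧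
    ∀ i, ContinuousOn (f i) (Set.Icc 0 T) ∧ Set.MapsTo (f i) (Set.Icc 0 T) (Set.Icc m M)

/-- `L_T(i) = exp(-∫_0^T ν_i(s) ds) ∏_{n=1}^{N_T(i)} (1 + ν_i(τ_n(i)) / β_i(τ_n(i)))`, computed from
the path `x = N_·(i)`. -/
noncomputable def localRatio (T : ℝ) (x : ℝ → ℕ) (b v : ℝ → ℝ) : ℝ :=
  Real.exp (-∫ s in (0 : ℝ)..T, v s) *
    ∏ n ∈ Finset.Icc 1 (x T), (1 + v (jumpTime T x n) / b (jumpTime T x n))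

/-- The likelihood ratio `L_T = ∏_{i=1}^k L_T(i)`. -/
noncomputable def likelihoodRatio {Ω : Type*} {k : ℕ} (T : ℝ) (N : Fin k → ℝ → Ω → ℕ)
    (β ν : Fin k → ℝ → ℝ) (ω : Ω) : ℝ :=
  ∏ i, localRatio T (fun t => N i t ω) (β i) (ν i)

/-- The measure `P₁` with `dP₁/dP₀ = L_T`, i.e. `P₁(A) = ∫_A L_T dP₀`. -/
noncomputable def tilted {Ω : Type*} [MeasurableSpace Ω] {k : ℕ} (P₀ : Measure Ω) (T : ℝ)
    (N : Fin k → ℝ → Ω → ℕ) (β ν : Fin k → ℝ → ℝ) : Measure Ω :=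
  P₀.withDensity (fun ω => ENNReal.ofReal (likelihoodRatio T N β ν ω))

end PoissonDetection

/-!
Over a cell of a partition of `[s, t]` whose tag is chosen by the mean value theorem, so that
`∫ φ b = φ(tag) ∫ b`, the factor `exp(-∫ (φ - 1) b) φ(tag)^n` is exactly the density of the Poisson
law with parameter `∫ φ b` with respect to the one with parameter `∫ b`. Hence the product of these
factors over the cells, each evaluated at the increment over the cell, turns the increment over
`(s, t]` into a Poisson variable with parameter `∫ φ b`, independent of the past of `s`. As the mesh
tends to zero, this product converges pathwise to the likelihood ratio of `(s, t]`, because the tag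
of the cell of a jump converges to the jump time, and it is dominated by a multiple of a power
`C ^ (N t - N s)`, which is integrable. The likelihood ratio is multiplicative over adjacent
intervals, so it has the martingale property, and the intensity of a single process becomes `φ b`.

For several independent processes the densities depend on independent paths, so their product keeps
the paths independent. This allows one to work with each process in its own filtration, and to
return to the joint filtration because the other paths are independent of that process.
-/

namespace PoissonDetection

open Filter Topology Set
open scoped ENNReal NNReal

section IndependentIncrements

variable {Ω E : Type*} {m mΩ : MeasurableSpace Ω} [MeasurableSpace E] {P : Measure Ω}

lemma lintegral_prodMk_of_indepFun {F : Type*} [MeasurableSpace F] [IsFiniteMeasure P] {X : Ω → E}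
    {Y : Ω → F} (hX : Measurable X) (hY : Measurable Y) (hXY : IndepFun X Y P) {f : E × F → ℝ≥0∞}
    (hf : Measurable f) :
    ∫⁻ ω, f (X ω, Y ω) ∂P = ∫⁻ y, ∫⁻ ω, f (X ω, y) ∂P ∂(P.map Y) := by
  rw [← lintegral_map hf (hX.prodMk hY),
    hXY.map_prod_eq_prod_map_map hX.aemeasurable hY.aemeasurable, lintegral_prod_symm' _ hf]
  exact lintegral_congr fun y => lintegral_map (hf.comp measurable_prodMk_right) hX

lemma lintegral_mul_eq_mul_of_setLIntegral_eq (hm : m ≤ mΩ)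
    {f : Ω → ℝ≥0∞} (hf : Measurable f) {c : ℝ≥0∞}
    (hc : ∀ A, MeasurableSet[m] A → ∫⁻ ω in A, f ω ∂P = P A * c) {X : Ω → ℝ≥0∞}
    (hX : Measurable[m] X) : ∫⁻ ω, X ω * f ω ∂P = (∫⁻ ω, X ω ∂P) * c := by
  have htrim : (P.withDensity f).trim hm = (c • P).trim hm := by
    refine @Measure.ext _ m _ _ fun A hA => ?_
    rw [trim_measurableSet_eq hm hA, trim_measurableSet_eq hm hA, withDensity_apply _ (hm A hA),
      hc A hA, Measure.smul_apply, smul_eq_mul, mul_comm]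
  calc ∫⁻ ω, X ω * f ω ∂P = ∫⁻ ω, X ω ∂(P.withDensity f) := by
        rw [lintegral_withDensity_eq_lintegral_mul _ hf (hX.mono hm le_rfl)]
        exact lintegral_congr fun ω => mul_comm _ _
    _ = ∫⁻ ω, X ω ∂(c • P) := by rw [← lintegral_trim hm hX, htrim, lintegral_trim hm hX]
    _ = (∫⁻ ω, X ω ∂P) * c := by rw [lintegral_smul_measure, smul_eq_mul, mul_comm]

lemma indep_and_hasLaw_of_measure_inter [IsProbabilityMeasure P] {D : Ω → E}
    (hD : Measurable D) {μ : Measure E}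
    (h : ∀ A, MeasurableSet[m] A → ∀ S, MeasurableSet S → P (A ∩ D ⁻¹' S) = P A * μ S) :
    Indep (MeasurableSpace.comap D inferInstance) m P ∧ HasLaw D μ P := by
  have hlaw : ∀ S, MeasurableSet S → P (D ⁻¹' S) = μ S := fun S hS => by
    simpa using h univ MeasurableSet.univ S hS
  constructor
  · rw [Indep_iff]
    rintro _ A ⟨S, hS, rfl⟩ hA
    rw [inter_comm, h A hA S hS, hlaw S hS, mul_comm]
  · refine ⟨hD.aemeasurable, Measure.ext fun S hS => ?_⟩
    rw [Measure.map_apply hD hS, hlaw S hS]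

/-- Each new increment is independent of everything accumulated so far, so reweighting it by `h m`
convolves the law of the partial sum with the reweighted law of the increment. -/
lemma lintegral_mul_prod_mul_comp_sum [AddCommMonoid E] [MeasurableAdd₂ E] [IsFiniteMeasure P]
    {𝒢 : Filtration ℕ mΩ} {D : ℕ → Ω → E} (hD : ∀ j, Measurable[𝒢 (j + 1)] (D j))
    (hind : ∀ j, Indep (MeasurableSpace.comap (D j) inferInstance) (𝒢 j) P)
    {h : ℕ → E → ℝ≥0∞} (hh : ∀ j, Measurable (h j)) {κ : ℕ → Measure E} [∀ m, SFinite (κ m)]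
    (hκ_zero : κ 0 = Measure.dirac 0)
    (hκ_succ : ∀ m, κ (m + 1) = (P.map (D m)).withDensity (h m) ∗ κ m)
    {X : Ω → ℝ≥0∞} (hX : Measurable[𝒢 0] X) {g : E → ℝ≥0∞} (hg : Measurable g) (m : ℕ) :
    ∫⁻ ω, X ω * (∏ j ∈ Finset.range m, h j (D j ω)) * g (∑ j ∈ Finset.range m, D j ω) ∂P =
      (∫⁻ ω, X ω ∂P) * ∫⁻ y, g y ∂κ m := by
  induction m generalizing g with
  | zero => simp [hκ_zero, lintegral_dirac' _ hg, lintegral_mul_const _ (hX.mono (𝒢.le 0) le_rfl)]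
  | succ m ih =>
    have hDm : ∀ j ∈ Finset.range m, Measurable[𝒢 m] (D j) := fun j hj =>
      (hD j).mono (𝒢.mono (Finset.mem_range.1 hj)) le_rfl
    set W : Ω → ℝ≥0∞ := fun ω => X ω * ∏ j ∈ Finset.range m, h j (D j ω)
    set S : Ω → E := fun ω => ∑ j ∈ Finset.range m, D j ω
    have hW : Measurable[𝒢 m] W := (hX.mono (𝒢.mono m.zero_le) le_rfl).mul
      (Finset.measurable_fun_prod _ fun j hj => (hh j).comp (hDm j hj))
    have hS : Measurable[𝒢 m] S := Finset.measurable_fun_sum _ hDm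
    have hD' : Measurable (D m) := (hD m).mono (𝒢.le _) le_rfl
    have hindep : IndepFun (fun ω => (W ω, S ω)) (D m) P :=
      (indep_of_indep_of_le_right (hind m) (measurable_iff_comap_le.1 (hW.prodMk hS))).symm
    calc ∫⁻ ω, X ω * (∏ j ∈ Finset.range (m + 1), h j (D j ω)) *
          g (∑ j ∈ Finset.range (m + 1), D j ω) ∂P
        = ∫⁻ ω, h m (D m ω) * (W ω * g (D m ω + S ω)) ∂P := by
          refine lintegral_congr fun ω => ?_
          rw [Finset.prod_range_succ, Finset.sum_range_succ, add_comm (∑ j ∈ _, D j ω)]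
          ring
      _ = ∫⁻ y, ∫⁻ ω, h m y * (W ω * g (y + S ω)) ∂P ∂(P.map (D m)) :=
          lintegral_prodMk_of_indepFun ((hW.prodMk hS).mono (𝒢.le m) le_rfl) hD' hindep
            (f := fun p => h m p.2 * (p.1.1 * g (p.2 + p.1.2))) (by fun_prop)
      _ = ∫⁻ y, h m y * ((∫⁻ ω, X ω ∂P) * ∫⁻ z, g (y + z) ∂κ m) ∂(P.map (D m)) := by
          refine lintegral_congr fun y => ?_
          rw [← ih (g := fun z => g (y + z)) (hg.comp (measurable_const_add y))]
          exact lintegral_const_mul _ ((hW.mono (𝒢.le m) le_rfl).mul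
            (hg.comp ((hS.mono (𝒢.le m) le_rfl).const_add y)))
      _ = (∫⁻ ω, X ω ∂P) *
            ∫⁻ y, ∫⁻ z, g (y + z) ∂κ m ∂((P.map (D m)).withDensity (h m)) := by
          have hinner : Measurable fun y => ∫⁻ z, g (y + z) ∂κ m :=
            (hg.comp measurable_add).lintegral_prod_right'
          rw [lintegral_withDensity_eq_lintegral_mul _ (hh m) hinner,
            ← lintegral_const_mul _ ((hh m).mul hinner)]
          exact lintegral_congr fun y => mul_left_comm _ _ _
      _ = (∫⁻ ω, X ω ∂P) * ∫⁻ y, g y ∂κ (m + 1) := by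
          rw [hκ_succ, Measure.lintegral_conv hg]

end IndependentIncrements

section PoissonLaw

lemma poissonMeasure_zero : poissonMeasure 0 = Measure.dirac 0 := by
  refine Measure.ext_of_singleton fun n => ?_
  rcases n with - | n <;> simp [poissonMeasure_singleton]

lemma poissonMeasure_withDensity (r c : ℝ≥0) :
    (poissonMeasure r).withDensity (fun n => ENNReal.ofReal (Real.exp (r - c * r) * c ^ n)) =
      poissonMeasure (c * r) := by
  refine Measure.ext_of_singleton fun n => ?_
  have hexp : Real.exp (-(c * r)) = Real.exp (r - c * r) * Real.exp (-r) := by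
    rw [← Real.exp_add]
    ring_nf
  rw [withDensity_apply _ (measurableSet_singleton n), lintegral_singleton,
    poissonMeasure_singleton, poissonMeasure_singleton, ← ENNReal.ofReal_mul (by positivity),
    NNReal.coe_mul, hexp]
  congr 1
  ring

lemma lintegral_pow_poissonMeasure_ne_top (r c : ℝ≥0) :
    ∫⁻ n, ENNReal.ofReal (c ^ n) ∂poissonMeasure r ≠ ∞ := by
  have hone : ENNReal.ofReal (Real.exp (r - c * r)) *
      ∫⁻ n, ENNReal.ofReal (c ^ n) ∂poissonMeasure r = 1 := by
    rw [← lintegral_const_mul _ measurable_from_top, ← measure_univ (μ := poissonMeasure (c * r)),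
      ← poissonMeasure_withDensity, withDensity_apply _ MeasurableSet.univ, Measure.restrict_univ]
    exact lintegral_congr fun n => (ENNReal.ofReal_mul (Real.exp_pos _).le).symm
  intro htop
  rw [htop, ENNReal.mul_top (by simp [Real.exp_pos])] at hone
  exact ENNReal.top_ne_one hone

end PoissonLaw

section CountingPaths

variable {T : ℝ} {x : ℝ → ℕ} {b φ : ℝ → ℝ}

lemma IsCountingPath.jumpTime_mem (hx : IsCountingPath T x) {p q : ℝ} (hp : p ∈ Icc 0 T)
    (hq : q ∈ Icc 0 T) {n : ℕ} (hn : n ∈ Finset.Ioc (x p) (x q)) : jumpTime T x n ∈ Icc p q := by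
  rw [Finset.mem_Ioc] at hn
  have hq_mem : q ∈ {t | t ∈ Icc 0 T ∧ n ≤ x t} := ⟨hq, hn.2⟩
  refine ⟨le_csInf ⟨q, hq_mem⟩ fun t ⟨ht, hnt⟩ => ?_, csInf_le ⟨0, fun t ht => ht.1.1⟩ hq_mem⟩
  by_contra! htp
  exact (hn.1.trans_le hnt).not_ge (hx.mono ht hp htp.le)

/-- The contribution of the time interval `(s, t]` to the likelihood ratio which multiplies an
intensity `b` by a factor `φ`, computed from the path `x`. -/
noncomputable def segmentRatio (T : ℝ) (b φ : ℝ → ℝ) (x : ℝ → ℕ) (s t : ℝ) : ℝ :=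
  Real.exp (-∫ z in s..t, (φ z - 1) * b z) * ∏ n ∈ Finset.Ioc (x s) (x t), φ (jumpTime T x n)

lemma segmentRatio_nonneg (hx : IsCountingPath T x) (hφ : ∀ z ∈ Icc 0 T, 0 ≤ φ z)
    (s t : Icc (0 : ℝ) T) : 0 ≤ segmentRatio T b φ x s t := by
  refine mul_nonneg (Real.exp_pos _).le (Finset.prod_nonneg fun n hn => hφ _ ?_)
  exact Icc_subset_Icc s.2.1 t.2.2 (hx.jumpTime_mem s.2 t.2 hn)

lemma intervalIntegrable_of_integrableOn_Icc {f : ℝ → ℝ} (hf : IntegrableOn f (Icc 0 T))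
    (s t : Icc (0 : ℝ) T) : IntervalIntegrable f volume s t :=
  (hf.mono_set (uIcc_subset_Icc s.2 t.2)).intervalIntegrable

lemma integrableOn_sub_one_mul (hb : IntegrableOn b (Icc 0 T)) (hφ : ContinuousOn φ (Icc 0 T)) :
    IntegrableOn (fun z => (φ z - 1) * b z) (Icc 0 T) :=
  hb.continuousOn_mul (hφ.sub continuousOn_const) isCompact_Icc

lemma segmentRatio_mul_segmentRatio (hx : IsCountingPath T x) (hb : IntegrableOn b (Icc 0 T))
    (hφ : ContinuousOn φ (Icc 0 T)) {r s t : Icc (0 : ℝ) T} (hrs : r ≤ s) (hst : s ≤ t) :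
    segmentRatio T b φ x r s * segmentRatio T b φ x s t = segmentRatio T b φ x r t := by
  have hint := integrableOn_sub_one_mul hb hφ
  simp only [segmentRatio]
  rw [← intervalIntegral.integral_add_adjacent_intervals
      (intervalIntegrable_of_integrableOn_Icc hint r s)
      (intervalIntegrable_of_integrableOn_Icc hint s t), neg_add, Real.exp_add,
    ← Finset.prod_Ioc_consecutive _ (hx.mono r.2 s.2 hrs) (hx.mono s.2 t.2 hst)]
  exact mul_mul_mul_comm _ _ _ _

lemma localRatio_eq_segmentRatio (hT : 0 ≤ T) (hx : IsCountingPath T x) {v : ℝ → ℝ}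
    (hb : ∀ z ∈ Icc 0 T, b z ≠ 0) :
    localRatio T x b v = segmentRatio T b (fun z => 1 + v z / b z) x 0 T := by
  have hint : ∫ z in (0 : ℝ)..T, (1 + v z / b z - 1) * b z = ∫ z in (0 : ℝ)..T, v z := by
    refine intervalIntegral.integral_congr fun z hz => ?_
    rw [uIcc_of_le hT] at hz
    rw [add_sub_cancel_left, div_mul_cancel₀ _ (hb z hz)]
  rw [localRatio, segmentRatio, hint, hx.zero]
  rfl

end CountingPaths

section MeanPartitions

lemma exists_prod_pow_eq_prod_Ioc {M : Type*} [CommMonoid M] {a : ℕ → ℕ} (ha : Monotone a)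
    (c : ℕ → M) (m : ℕ) :
    ∃ cell : ℕ → ℕ, (∀ n ∈ Finset.Ioc (a 0) (a m), n ∈ Finset.Ioc (a (cell n)) (a (cell n + 1))) ∧
      ∏ j ∈ Finset.range m, c j ^ (a (j + 1) - a j) = ∏ n ∈ Finset.Ioc (a 0) (a m), c (cell n) := by
  induction m with
  | zero => exact ⟨0, by simp⟩
  | succ m ih =>
    obtain ⟨cell, hcell, hprod⟩ := ih
    refine ⟨fun n => if n ≤ a m then cell n else m, fun n hn => ?_, ?_⟩
    · rw [Finset.mem_Ioc] at hn
      by_cases hnm : n ≤ a m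
      · simpa only [hnm, if_true] using hcell n (Finset.mem_Ioc.2 ⟨hn.1, hnm⟩)
      · simpa only [hnm, if_false] using Finset.mem_Ioc.2 ⟨not_le.1 hnm, hn.2⟩
    · rw [Finset.prod_range_succ, hprod,
        ← Finset.prod_Ioc_consecutive _ (ha m.zero_le) (ha m.le_succ)]
      congr 1
      · exact Finset.prod_congr rfl fun n hn => congrArg c (if_pos (Finset.mem_Ioc.1 hn).2).symm
      · rw [← Nat.card_Ioc, ← Finset.prod_const]
        exact Finset.prod_congr rfl fun n hn =>
          congrArg c (if_neg (Finset.mem_Ioc.1 hn).1.not_ge).symm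

variable {T : ℝ}

/-- A partition of `[s, t]` of mesh at most `ε`, each cell of which carries a tag where `φ` takes
its mean value with respect to `b`. The sequence `node` is indexed by all of `ℕ`, but only its
first `card + 1` terms form the partition. -/
structure MeanPartition (b φ : ℝ → ℝ) (s t : Icc (0 : ℝ) T) (ε : ℝ) where
  card : ℕ
  node : ℕ → Icc (0 : ℝ) T
  tag : ℕ → ℝ
  monotone_node : Monotone node
  node_zero : node 0 = s
  node_card : node card = t
  mesh_le : ∀ j, (node (j + 1) : ℝ) - node j ≤ ε
  tag_mem : ∀ j, tag j ∈ Icc (node j : ℝ) (node (j + 1))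
  integral_eq : ∀ j, ∫ z in (node j : ℝ)..node (j + 1), φ z * b z =
    φ (tag j) * ∫ z in (node j : ℝ)..node (j + 1), b z

variable {b φ : ℝ → ℝ} {s t : Icc (0 : ℝ) T} {ε : ℝ}

lemma nonempty_meanPartition (hb : IntegrableOn b (Icc 0 T)) (hb_nonneg : ∀ z ∈ Icc 0 T, 0 ≤ b z)
    (hφ : ContinuousOn φ (Icc 0 T)) (hst : s ≤ t) (hε : 0 < ε) :
    Nonempty (MeanPartition b φ s t ε) := by
  have hst' : (s : ℝ) ≤ t := hst
  let u : ℕ → Icc (s : ℝ) t := Icc.addNSMul hst' ε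
  let node : ℕ → Icc (0 : ℝ) T := fun j => inclusion (Icc_subset_Icc s.2.1 t.2.2) (u j)
  have hu : Monotone u := Icc.monotone_addNSMul hst' hε.le
  have hle : ∀ j, (node j : ℝ) ≤ node (j + 1) := fun j => hu j.le_succ
  have hmean : ∀ j, ∃ c ∈ Icc (node j : ℝ) (node (j + 1)),
      ∫ z in (node j : ℝ)..node (j + 1), φ z * b z =
        φ c * ∫ z in (node j : ℝ)..node (j + 1), b z := fun j => by
    have hsub : Icc (node j : ℝ) (node (j + 1)) ⊆ Icc 0 T :=
      Icc_subset_Icc (node j).2.1 (node (j + 1)).2.2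
    rw [← uIcc_of_le (hle j)] at hsub ⊢
    exact exists_eq_const_mul_intervalIntegral_of_nonneg (hφ.mono hsub)
      (intervalIntegrable_of_integrableOn_Icc hb _ _)
      fun z hz => hb_nonneg z (hsub (uIoc_subset_uIcc hz))
  choose tag htag_mem htag using hmean
  obtain ⟨m, hm⟩ := Icc.addNSMul_eq_right hst' hε
  exact ⟨{
    card := m
    node := node
    tag := tag
    monotone_node := hu
    node_zero := Subtype.ext (Icc.addNSMul_zero hst')
    node_card := Subtype.ext (hm m le_rfl)
    mesh_le := fun j => (le_abs_self _).trans
      (Icc.abs_sub_addNSMul_le hst' hε.le (t := u (j + 1)) j ⟨hu j.le_succ, le_rfl⟩)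
    tag_mem := htag_mem
    integral_eq := htag }⟩

namespace MeanPartition

variable (π : MeanPartition b φ s t ε)

/-- The likelihood ratio of the `j`-th cell when it contains `n` jumps and `φ` is frozen at the
tag. -/
noncomputable def weight (j n : ℕ) : ℝ :=
  Real.exp (-∫ z in (π.node j : ℝ)..π.node (j + 1), (φ z - 1) * b z) * φ (π.tag j) ^ n

/-- The approximation of `segmentRatio` that freezes `φ` on the cells of the partition, and hence
depends on the path `x` only through its increments over the cells. -/
noncomputable def ratio (x : ℝ → ℕ) : ℝ :=
  ∏ j ∈ Finset.range π.card, π.weight j (x (π.node (j + 1)) - x (π.node j))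

lemma tag_mem_Icc (j : ℕ) : π.tag j ∈ Icc 0 T :=
  Icc_subset_Icc (π.node j).2.1 (π.node (j + 1)).2.2 (π.tag_mem j)

lemma weight_nonneg (hφ : ∀ z ∈ Icc 0 T, 0 ≤ φ z) (j n : ℕ) : 0 ≤ π.weight j n :=
  mul_nonneg (Real.exp_pos _).le (pow_nonneg (hφ _ (π.tag_mem_Icc j)) n)

lemma exists_ratio_eq (hb : IntegrableOn b (Icc 0 T)) (hφ : ContinuousOn φ (Icc 0 T))
    {x : ℝ → ℕ} (hx : IsCountingPath T x) :
    ∃ cell : ℕ → ℕ, (∀ n ∈ Finset.Ioc (x s) (x t),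
        n ∈ Finset.Ioc (x (π.node (cell n))) (x (π.node (cell n + 1)))) ∧
      π.ratio x = Real.exp (-∫ z in (s : ℝ)..t, (φ z - 1) * b z) *
        ∏ n ∈ Finset.Ioc (x s) (x t), φ (π.tag (cell n)) := by
  have hmono : Monotone fun j => x (π.node j) := fun i j hij =>
    hx.mono (π.node i).2 (π.node j).2 (π.monotone_node hij)
  obtain ⟨cell, hcell, hprod⟩ := exists_prod_pow_eq_prod_Ioc hmono (fun j => φ (π.tag j)) π.card
  have hsum := intervalIntegral.sum_integral_adjacent_intervals
    (a := fun j => (π.node j : ℝ)) (n := π.card)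
    fun j _ => intervalIntegrable_of_integrableOn_Icc (integrableOn_sub_one_mul hb hφ) _ _
  simp only [π.node_zero, π.node_card] at hcell hprod hsum
  refine ⟨cell, hcell, ?_⟩
  simp only [ratio, weight]
  rw [Finset.prod_mul_distrib, ← Real.exp_sum, Finset.sum_neg_distrib, hsum, hprod]

lemma ratio_le (hb : IntegrableOn b (Icc 0 T)) (hφ : ContinuousOn φ (Icc 0 T))
    (hφ_nonneg : ∀ z ∈ Icc 0 T, 0 ≤ φ z) {C : ℝ} (hC : ∀ z ∈ Icc 0 T, φ z ≤ C)
    {x : ℝ → ℕ} (hx : IsCountingPath T x) :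
    π.ratio x ≤ Real.exp (-∫ z in (s : ℝ)..t, (φ z - 1) * b z) * C ^ (x t - x s) := by
  obtain ⟨cell, -, hratio⟩ := π.exists_ratio_eq hb hφ hx
  rw [hratio, ← Nat.card_Ioc, ← Finset.prod_const]
  gcongr with n
  exacts [fun n _ => hφ_nonneg _ (π.tag_mem_Icc _), hC _ (π.tag_mem_Icc _)]

lemma tendsto_ratio (hb : IntegrableOn b (Icc 0 T)) (hφ : ContinuousOn φ (Icc 0 T))
    {ι : Type*} {l : Filter ι} {ε : ι → ℝ} (hε : Tendsto ε l (𝓝 0))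
    (π : ∀ i, MeanPartition b φ s t (ε i)) {x : ℝ → ℕ} (hx : IsCountingPath T x) :
    Tendsto (fun i => (π i).ratio x) l (𝓝 (segmentRatio T b φ x s t)) := by
  choose cell hcell hratio using fun i => (π i).exists_ratio_eq hb hφ hx
  simp only [hratio]
  refine (tendsto_finsetProd _ fun n hn => ?_).const_mul _
  have hτ : jumpTime T x n ∈ Icc 0 T :=
    Icc_subset_Icc s.2.1 t.2.2 (hx.jumpTime_mem s.2 t.2 hn)
  have htag : Tendsto (fun i => (π i).tag (cell i n)) l (𝓝 (jumpTime T x n)) := by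
    refine tendsto_iff_dist_tendsto_zero.2 (squeeze_zero (fun _ => dist_nonneg) (fun i => ?_) hε)
    exact (Real.dist_le_of_mem_Icc ((π i).tag_mem _)
      (hx.jumpTime_mem (Subtype.prop _) (Subtype.prop _) (hcell i n hn))).trans ((π i).mesh_le _)
  exact (hφ _ hτ).tendsto.comp
    (tendsto_nhdsWithin_iff.2 ⟨htag, Eventually.of_forall fun i => (π i).tag_mem_Icc _⟩)

end MeanPartition

end MeanPartitions

section PoissonProcesses

variable {Ω : Type*} {mΩ : MeasurableSpace Ω} {T : ℝ} {P : Measure Ω}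
  {ℱ : Filtration (Icc (0 : ℝ) T) mΩ} {N : ℝ → Ω → ℕ} {b φ : ℝ → ℝ} {s t : Icc (0 : ℝ) T}

lemma MeanPartition.withDensity_weight {ε : ℝ} (π : MeanPartition b φ s t ε)
    (hb : IntegrableOn b (Icc 0 T)) (hb_nonneg : ∀ z ∈ Icc 0 T, 0 ≤ b z)
    (hφ : ContinuousOn φ (Icc 0 T)) (hφ_nonneg : ∀ z ∈ Icc 0 T, 0 ≤ φ z) (j : ℕ) :
    (poissonMeasure (∫ z in (π.node j : ℝ)..π.node (j + 1), b z).toNNReal).withDensity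
        (fun n => ENNReal.ofReal (π.weight j n)) =
      poissonMeasure (∫ z in (π.node j : ℝ)..π.node (j + 1), φ z * b z).toNNReal := by
  have hc := hφ_nonneg _ (π.tag_mem_Icc j)
  have hr : 0 ≤ ∫ z in (π.node j : ℝ)..π.node (j + 1), b z :=
    intervalIntegral.integral_nonneg (π.monotone_node j.le_succ) fun z hz =>
      hb_nonneg z (Icc_subset_Icc (π.node j).2.1 (π.node (j + 1)).2.2 hz)
  have hexp : -∫ z in (π.node j : ℝ)..π.node (j + 1), (φ z - 1) * b z =
      (∫ z in (π.node j : ℝ)..π.node (j + 1), b z) -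
        φ (π.tag j) * ∫ z in (π.node j : ℝ)..π.node (j + 1), b z := by
    rw [← π.integral_eq, ← intervalIntegral.integral_sub
      (intervalIntegrable_of_integrableOn_Icc hb _ _)
      (intervalIntegrable_of_integrableOn_Icc (hb.continuousOn_mul hφ isCompact_Icc) _ _),
      ← intervalIntegral.integral_neg]
    exact intervalIntegral.integral_congr fun z _ => by ring
  rw [π.integral_eq, Real.toNNReal_mul hc, ← poissonMeasure_withDensity]
  simp only [weight, hexp, Real.coe_toNNReal _ hc, Real.coe_toNNReal _ hr]

namespace IsPoissonProcess

lemma measurable_sub (hP : IsPoissonProcess P ℱ N b) {u : Icc (0 : ℝ) T} (hs : s ≤ u)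
    (ht : t ≤ u) : Measurable[ℱ u] fun ω => N t ω - N s ω :=
  Measurable.sub ((hP.adapted t).mono (ℱ.mono ht) le_rfl)
    ((hP.adapted s).mono (ℱ.mono hs) le_rfl)

lemma measurable_ratio (hP : IsPoissonProcess P ℱ N b) {ε : ℝ} (π : MeanPartition b φ s t ε) :
    Measurable[ℱ t] fun ω => π.ratio fun z => N z ω := by
  have hle : ∀ j ≤ π.card, π.node j ≤ t := fun j hj =>
    (π.monotone_node hj).trans_eq π.node_card
  exact Finset.measurable_fun_prod _ fun j hj =>
    (measurable_from_top (f := π.weight j)).comp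
      (hP.measurable_sub (hle _ (Finset.mem_range.1 hj).le) (hle _ (Finset.mem_range.1 hj)))

lemma lintegral_mul_ratio_mul [IsFiniteMeasure P] (hP : IsPoissonProcess P ℱ N b)
    (hφ : ContinuousOn φ (Icc 0 T)) (hφ_nonneg : ∀ z ∈ Icc 0 T, 0 ≤ φ z) {ε : ℝ}
    (π : MeanPartition b φ s t ε) {X : Ω → ℝ≥0∞} (hX : Measurable[ℱ s] X) (g : ℕ → ℝ≥0∞) :
    ∫⁻ ω, X ω * ENNReal.ofReal (π.ratio fun z => N z ω) * g (N t ω - N s ω) ∂P =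
      (∫⁻ ω, X ω ∂P) * ∫⁻ n, g n ∂poissonMeasure (∫ z in (s : ℝ)..t, φ z * b z).toNNReal := by
  have hint := fun p q => intervalIntegrable_of_integrableOn_Icc (s := p) (t := q)
    (hP.intensity_integrable.continuousOn_mul hφ isCompact_Icc)
  have hint_nonneg : ∀ {p q : Icc (0 : ℝ) T}, p ≤ q → 0 ≤ ∫ z in (p : ℝ)..q, φ z * b z :=
    fun {p q} hpq => intervalIntegral.integral_nonneg hpq fun z hz =>
      have hz' := Icc_subset_Icc p.2.1 q.2.2 hz
      mul_nonneg (hφ_nonneg z hz') (hP.intensity_nonneg z hz')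
  let 𝒢 : Filtration ℕ mΩ :=
    ⟨fun j => ℱ (π.node j), fun _ _ hij => ℱ.mono (π.monotone_node hij), fun j => ℱ.le _⟩
  have hs : ∀ j, s ≤ π.node j := fun j =>
    π.node_zero.symm.trans_le (π.monotone_node j.zero_le)
  have hcell : ∀ j, π.node j ≤ π.node (j + 1) := fun j => π.monotone_node j.le_succ
  have key := lintegral_mul_prod_mul_comp_sum (P := P) (𝒢 := 𝒢)
    (D := fun j ω => N (π.node (j + 1)) ω - N (π.node j) ω)
    (fun j => hP.measurable_sub (hcell j) le_rfl) (fun j => hP.indep _ _ (hcell j))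
    (h := fun j n => ENNReal.ofReal (π.weight j n)) (fun j => measurable_from_top)
    (κ := fun m => poissonMeasure (∫ z in (s : ℝ)..π.node m, φ z * b z).toNNReal)
    (by simp [π.node_zero, poissonMeasure_zero])
    (fun m => by
      rw [(hP.law _ _ (hcell m)).map_eq, π.withDensity_weight hP.intensity_integrable
        hP.intensity_nonneg hφ hφ_nonneg, poissonMeasure_conv_poissonMeasure,
        ← Real.toNNReal_add (hint_nonneg (hcell m)) (hint_nonneg (hs m)),
        ← intervalIntegral.integral_add_adjacent_intervals (hint s (π.node m)) (hint _ _),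
        add_comm (∫ z in (s : ℝ)..π.node m, φ z * b z)])
    (X := X) (show Measurable[ℱ (π.node 0)] X by rwa [π.node_zero]) (g := g) measurable_from_top
    π.card
  have hsum : ∀ ω, ∑ j ∈ Finset.range π.card, (N (π.node (j + 1)) ω - N (π.node j) ω) =
      N t ω - N s ω := fun ω => by
    have hmono : Monotone fun j => N (π.node j) ω := fun i j hij =>
      (hP.counting ω).mono (π.node i).2 (π.node j).2 (π.monotone_node hij)
    rw [Finset.sum_range_tsub hmono, π.node_zero, π.node_card]
  simp only [hsum, π.node_card] at key
  simpa only [MeanPartition.ratio,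
    ENNReal.ofReal_prod_of_nonneg fun j _ => π.weight_nonneg hφ_nonneg j _] using key

lemma setLIntegral_ratio [IsFiniteMeasure P] (hP : IsPoissonProcess P ℱ N b)
    (hφ : ContinuousOn φ (Icc 0 T)) (hφ_nonneg : ∀ z ∈ Icc 0 T, 0 ≤ φ z) {ε : ℝ}
    (π : MeanPartition b φ s t ε) {A : Set Ω} (hA : MeasurableSet[ℱ s] A) (S : Set ℕ) :
    ∫⁻ ω in A ∩ (fun ω => N t ω - N s ω) ⁻¹' S, ENNReal.ofReal (π.ratio fun z => N z ω) ∂P =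
      P A * poissonMeasure (∫ z in (s : ℝ)..t, φ z * b z).toNNReal S := by
  have hst : s ≤ t := (π.node_zero.symm.trans_le (π.monotone_node π.card.zero_le)).trans_eq
    π.node_card
  have hAS : MeasurableSet (A ∩ (fun ω => N t ω - N s ω) ⁻¹' S) :=
    (ℱ.le s A hA).inter (((hP.measurable_sub hst le_rfl).mono (ℱ.le t) le_rfl)
      (MeasurableSet.of_discrete (s := S)))
  have key := hP.lintegral_mul_ratio_mul hφ hφ_nonneg π
    (X := A.indicator 1) (measurable_const.indicator hA) (S.indicator 1)
  rw [lintegral_indicator_one (ℱ.le s A hA),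
    lintegral_indicator_one MeasurableSet.of_discrete] at key
  rw [← key, ← lintegral_indicator hAS]
  refine lintegral_congr fun ω => ?_
  by_cases hωA : ω ∈ A <;> by_cases hωS : N t ω - N s ω ∈ S <;> simp [hωA, hωS]

lemma lintegral_pow_sub_ne_top (hP : IsPoissonProcess P ℱ N b) (hst : s ≤ t) (c : ℝ≥0) :
    ∫⁻ ω, ENNReal.ofReal (c ^ (N t ω - N s ω)) ∂P ≠ ∞ := by
  rw [(hP.law s t hst).lintegral_comp (f := fun n => ENNReal.ofReal (c ^ n))
    measurable_from_top.aemeasurable]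
  exact lintegral_pow_poissonMeasure_ne_top _ c

end IsPoissonProcess

lemma exists_seq_meanPartition_tendsto_ratio (hb : IntegrableOn b (Icc 0 T))
    (hb_nonneg : ∀ z ∈ Icc 0 T, 0 ≤ b z) (hφ : ContinuousOn φ (Icc 0 T)) (hst : s ≤ t) :
    ∃ (ε : ℕ → ℝ) (π : ∀ n, MeanPartition b φ s t (ε n)), ∀ x : ℝ → ℕ, IsCountingPath T x →
      Tendsto (fun n => (π n).ratio x) atTop (𝓝 (segmentRatio T b φ x s t)) :=
  ⟨fun n => 1 / (n + 1),
    fun _ => (nonempty_meanPartition hb hb_nonneg hφ hst Nat.one_div_pos_of_nat).some,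
    fun _ hx => MeanPartition.tendsto_ratio hb hφ tendsto_one_div_add_atTop_nhds_zero_nat _ hx⟩

/-- `segmentRatio` of the random path `N`, as a density. -/
noncomputable def segmentDensity (T : ℝ) (b φ : ℝ → ℝ) (N : ℝ → Ω → ℕ) (s t : ℝ) (ω : Ω) :
    ℝ≥0∞ :=
  ENNReal.ofReal (segmentRatio T b φ (fun z => N z ω) s t)

namespace IsPoissonProcess

lemma measurable_segmentRatio (hP : IsPoissonProcess P ℱ N b) (hφ : ContinuousOn φ (Icc 0 T))
    (hst : s ≤ t) : Measurable[ℱ t] fun ω => segmentRatio T b φ (fun z => N z ω) s t := by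
  obtain ⟨ε, π, hπ⟩ := exists_seq_meanPartition_tendsto_ratio hP.intensity_integrable
    hP.intensity_nonneg hφ hst
  exact @measurable_of_tendsto_metrizable _ _ (ℱ t) _ _ _ _ _ _
    (fun n => hP.measurable_ratio (π n)) (tendsto_pi_nhds.2 fun ω => hπ _ (hP.counting ω))

lemma measurable_segmentDensity (hP : IsPoissonProcess P ℱ N b) (hφ : ContinuousOn φ (Icc 0 T))
    (hst : s ≤ t) : Measurable[ℱ t] (segmentDensity T b φ N s t) :=
  (hP.measurable_segmentRatio hφ hst).ennreal_ofReal

lemma segmentDensity_mul_segmentDensity (hP : IsPoissonProcess P ℱ N b)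
    (hφ : ContinuousOn φ (Icc 0 T)) (hφ_nonneg : ∀ z ∈ Icc 0 T, 0 ≤ φ z) {r : Icc (0 : ℝ) T}
    (hrs : r ≤ s) (hst : s ≤ t) (ω : Ω) :
    segmentDensity T b φ N r s ω * segmentDensity T b φ N s t ω =
      segmentDensity T b φ N r t ω := by
  rw [segmentDensity, segmentDensity,
    ← ENNReal.ofReal_mul (segmentRatio_nonneg (hP.counting ω) hφ_nonneg r s),
    segmentRatio_mul_segmentRatio (hP.counting ω) hP.intensity_integrable hφ hrs hst,
    segmentDensity]

lemma setLIntegral_segmentDensity [IsFiniteMeasure P] (hP : IsPoissonProcess P ℱ N b)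
    (hφ : ContinuousOn φ (Icc 0 T)) (hφ_nonneg : ∀ z ∈ Icc 0 T, 0 ≤ φ z) (hst : s ≤ t)
    {A : Set Ω} (hA : MeasurableSet[ℱ s] A) (S : Set ℕ) :
    ∫⁻ ω in A ∩ (fun ω => N t ω - N s ω) ⁻¹' S, segmentDensity T b φ N s t ω ∂P =
      P A * poissonMeasure (∫ z in (s : ℝ)..t, φ z * b z).toNNReal S := by
  obtain ⟨ε, π, hπ⟩ := exists_seq_meanPartition_tendsto_ratio hP.intensity_integrable
    hP.intensity_nonneg hφ hst
  obtain ⟨C, hC⟩ := (isCompact_Icc.image_of_continuousOn hφ).bddAbove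
  have hC' : ∀ z ∈ Icc 0 T, φ z ≤ C.toNNReal := fun z hz =>
    (hC (mem_image_of_mem φ hz)).trans (Real.le_coe_toNNReal C)
  have hlim : Tendsto (fun n => ∫⁻ ω in A ∩ (fun ω => N t ω - N s ω) ⁻¹' S,
      ENNReal.ofReal ((π n).ratio fun z => N z ω) ∂P) atTop
      (𝓝 (∫⁻ ω in A ∩ (fun ω => N t ω - N s ω) ⁻¹' S, segmentDensity T b φ N s t ω ∂P)) := by
    refine tendsto_lintegral_of_dominated_convergence
      (fun ω => ENNReal.ofReal (Real.exp (-∫ z in (s : ℝ)..t, (φ z - 1) * b z)) *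
        ENNReal.ofReal (C.toNNReal ^ (N t ω - N s ω)))
      (fun n => ((hP.measurable_ratio (π n)).mono (ℱ.le t) le_rfl).ennreal_ofReal)
      (fun n => ae_of_all _ fun ω => ?_) ?_
      (ae_of_all _ fun ω => ENNReal.tendsto_ofReal (hπ _ (hP.counting ω)))
    · dsimp only
      rw [← ENNReal.ofReal_mul (Real.exp_pos _).le]
      exact ENNReal.ofReal_le_ofReal
        ((π n).ratio_le hP.intensity_integrable hφ hφ_nonneg hC' (hP.counting ω))
    · rw [lintegral_const_mul' _ _ ENNReal.ofReal_ne_top]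
      exact ENNReal.mul_ne_top ENNReal.ofReal_ne_top
        (ne_top_of_le_ne_top (hP.lintegral_pow_sub_ne_top hst _) (setLIntegral_le_lintegral _ _))
  simp only [hP.setLIntegral_ratio hφ hφ_nonneg (π _) hA S] at hlim
  exact tendsto_nhds_unique hlim tendsto_const_nhds

lemma setLIntegral_inter_segmentDensity [IsFiniteMeasure P] (hP : IsPoissonProcess P ℱ N b)
    (hφ : ContinuousOn φ (Icc 0 T)) (hφ_nonneg : ∀ z ∈ Icc 0 T, 0 ≤ φ z) {r : Icc (0 : ℝ) T}
    (hrs : r ≤ s) (hst : s ≤ t) {A : Set Ω} (hA : MeasurableSet[ℱ s] A) (S : Set ℕ) :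
    ∫⁻ ω in A ∩ (fun ω => N t ω - N s ω) ⁻¹' S, segmentDensity T b φ N r t ω ∂P =
      (∫⁻ ω in A, segmentDensity T b φ N r s ω ∂P) *
        poissonMeasure (∫ z in (s : ℝ)..t, φ z * b z).toNNReal S := by
  have hD : MeasurableSet ((fun ω => N t ω - N s ω) ⁻¹' S) :=
    ℱ.le t _ (hP.measurable_sub hst le_rfl (MeasurableSet.of_discrete (s := S)))
  have key := lintegral_mul_eq_mul_of_setLIntegral_eq (P := P) (ℱ.le s)
    (((hP.measurable_segmentDensity hφ hst).mono (ℱ.le t) le_rfl).indicator hD)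
    (fun B hB => by
      rw [setLIntegral_indicator hD, inter_comm,
        hP.setLIntegral_segmentDensity hφ hφ_nonneg hst hB S])
    ((hP.measurable_segmentDensity hφ hrs).indicator hA)
  rw [lintegral_indicator (ℱ.le s A hA)] at key
  rw [← key, ← lintegral_indicator ((ℱ.le s A hA).inter hD)]
  refine lintegral_congr fun ω => ?_
  rw [← inter_indicator_mul]
  simp only [indicator, hP.segmentDensity_mul_segmentDensity hφ hφ_nonneg hrs hst]

theorem girsanov [IsFiniteMeasure P] (hT : 0 ≤ T)
    (hP : IsPoissonProcess P ℱ N b) (hφ : ContinuousOn φ (Icc 0 T))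
    (hφ_nonneg : ∀ z ∈ Icc 0 T, 0 ≤ φ z) {Q : Measure Ω} [IsProbabilityMeasure Q]
    (hQ : ∀ A, MeasurableSet[ℱ ⟨T, hT, le_rfl⟩] A →
      Q A = ∫⁻ ω in A, segmentDensity T b φ N 0 T ω ∂P) :
    IsPoissonProcess Q ℱ N fun z => φ z * b z := by
  have hinter := fun {s t : Icc (0 : ℝ) T} => hP.setLIntegral_inter_segmentDensity hφ hφ_nonneg
    (r := ⟨0, le_rfl, hT⟩) (s := s) (t := t) s.2.1
  have hQ_of_le : ∀ u : Icc (0 : ℝ) T, ∀ A, MeasurableSet[ℱ u] A →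
      Q A = ∫⁻ ω in A, segmentDensity T b φ N 0 u ω ∂P := fun u A hA => by
    have hu : u ≤ ⟨T, hT, le_rfl⟩ := u.2.2
    have huniv := hinter hu hA univ
    rw [preimage_univ, inter_univ, measure_univ, mul_one] at huniv
    exact (hQ A (ℱ.mono hu A hA)).trans huniv
  have hincrement : ∀ s t : Icc (0 : ℝ) T, s ≤ t →
      Indep (MeasurableSpace.comap (fun ω => N t ω - N s ω) inferInstance) (ℱ s) Q ∧
        HasLaw (fun ω => N t ω - N s ω)
          (poissonMeasure (∫ z in (s : ℝ)..t, φ z * b z).toNNReal) Q := fun s t hst =>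
    have hD : Measurable[ℱ t] fun ω => N t ω - N s ω := hP.measurable_sub hst le_rfl
    indep_and_hasLaw_of_measure_inter (hD.mono (ℱ.le t) le_rfl) fun A hA S hS => by
      rw [hQ_of_le t _ ((ℱ.mono hst A hA).inter (hD hS)), hinter hst hA S, hQ_of_le s A hA]
  exact {
    intensity_nonneg := fun z hz => mul_nonneg (hφ_nonneg z hz) (hP.intensity_nonneg z hz)
    intensity_measurable :=
      (continuousOn_iff_continuous_domRestrict.1 hφ).measurable.mul hP.intensity_measurable
    intensity_integrable := hP.intensity_integrable.continuousOn_mul hφ isCompact_Icc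
    counting := hP.counting
    adapted := hP.adapted
    indep := fun s t hst => (hincrement s t hst).1
    law := fun s t hst => (hincrement s t hst).2 }

lemma congr (hP : IsPoissonProcess P ℱ N b) {c : ℝ → ℝ} (hbc : EqOn b c (Icc 0 T)) :
    IsPoissonProcess P ℱ N c where
  intensity_nonneg z hz := hbc hz ▸ hP.intensity_nonneg z hz
  intensity_measurable := by
    convert hP.intensity_measurable using 2 with z
    exact (hbc z.2).symm
  intensity_integrable := hP.intensity_integrable.congr_fun hbc measurableSet_Icc
  counting := hP.counting
  adapted := hP.adapted
  indep := hP.indep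
  law s t hst := by
    rw [← intervalIntegral.integral_congr (hbc.mono (uIcc_subset_Icc s.2 t.2))]
    exact hP.law s t hst

end IsPoissonProcess

end PoissonProcesses

section ProductDensities

variable {Ω ι : Type*} [Fintype ι] {mΩ : MeasurableSpace Ω} {P : Measure Ω}
  {m : ι → MeasurableSpace Ω} {Z : ι → Ω → ℝ≥0∞}

lemma withDensity_prod_biInter (hm : ∀ i, m i ≤ mΩ) (hind : iIndep m P)
    (hZ : ∀ i, Measurable[m i] (Z i)) (hZ_one : ∀ i, ∫⁻ ω, Z i ω ∂P = 1) (s : Finset ι)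
    {A : ι → Set Ω} (hA : ∀ i ∈ s, MeasurableSet[m i] (A i)) :
    P.withDensity (fun ω => ∏ i, Z i ω) (⋂ i ∈ s, A i) = ∏ i ∈ s, ∫⁻ ω in A i, Z i ω ∂P := by
  classical
  let Y : ι → Ω → ℝ≥0∞ := fun i => if i ∈ s then (A i).indicator (Z i) else Z i
  have hY : ∀ i, Measurable[m i] (Y i) := fun i => by
    by_cases hi : i ∈ s
    · simpa only [Y, if_pos hi] using (hZ i).indicator (hA i hi)
    · simpa only [Y, if_neg hi] using hZ i
  have hY_ind : iIndepFun Y P := by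
    rw [iIndepFun_iff]
    rw [iIndep_iff] at hind
    exact fun t f hf => hind t fun i hi => (hY i).comap_le _ (hf i hi)
  have hA_meas : MeasurableSet (⋂ i ∈ s, A i) :=
    s.measurableSet_biInter fun i hi => hm i _ (hA i hi)
  have hY_prod : ∀ ω, (⋂ i ∈ s, A i).indicator (fun ω => ∏ i, Z i ω) ω = ∏ i, Y i ω := fun ω => by
    by_cases hω : ∀ i ∈ s, ω ∈ A i
    · rw [indicator_of_mem (mem_iInter₂.2 hω)]
      refine Finset.prod_congr rfl fun i _ => ?_
      by_cases hi : i ∈ s <;> simp [Y, hi, hω]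
    · rw [indicator_of_notMem (mt mem_iInter₂.1 hω)]
      push Not at hω
      obtain ⟨i, hi, hωi⟩ := hω
      exact (Finset.prod_eq_zero (Finset.mem_univ i) (by simp [Y, hi, hωi])).symm
  calc P.withDensity (fun ω => ∏ i, Z i ω) (⋂ i ∈ s, A i)
      = ∫⁻ ω, ∏ i, Y i ω ∂P := by
        rw [withDensity_apply _ hA_meas, ← lintegral_indicator hA_meas]
        exact lintegral_congr hY_prod
    _ = ∏ i, ∫⁻ ω, Y i ω ∂P :=
        lintegral_prod_eq_prod_lintegral_of_indepFun _ _ hY_ind fun i => (hY i).mono (hm i) le_rfl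
    _ = ∏ i, if i ∈ s then ∫⁻ ω in A i, Z i ω ∂P else 1 := by
        refine Finset.prod_congr rfl fun i _ => ?_
        by_cases hi : i ∈ s
        · simp only [Y, if_pos hi, lintegral_indicator (hm i _ (hA i hi))]
        · simp only [Y, if_neg hi, hZ_one]
    _ = ∏ i ∈ s, ∫⁻ ω in A i, Z i ω ∂P := Finset.prod_ite_mem_eq s _

lemma isProbabilityMeasure_withDensity_prod (hm : ∀ i, m i ≤ mΩ) (hind : iIndep m P)
    (hZ : ∀ i, Measurable[m i] (Z i)) (hZ_one : ∀ i, ∫⁻ ω, Z i ω ∂P = 1) :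
    IsProbabilityMeasure (P.withDensity fun ω => ∏ i, Z i ω) :=
  ⟨by simpa using withDensity_prod_biInter hm hind hZ hZ_one ∅ (A := fun _ => univ) (by simp)⟩

lemma withDensity_prod_apply (hm : ∀ i, m i ≤ mΩ) (hind : iIndep m P)
    (hZ : ∀ i, Measurable[m i] (Z i)) (hZ_one : ∀ i, ∫⁻ ω, Z i ω ∂P = 1) {i : ι} {A : Set Ω}
    (hA : MeasurableSet[m i] A) :
    P.withDensity (fun ω => ∏ i, Z i ω) A = ∫⁻ ω in A, Z i ω ∂P := by
  simpa using withDensity_prod_biInter hm hind hZ hZ_one {i} (A := fun _ => A) (by simpa using hA)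

lemma iIndep_withDensity_prod (hm : ∀ i, m i ≤ mΩ) (hind : iIndep m P)
    (hZ : ∀ i, Measurable[m i] (Z i)) (hZ_one : ∀ i, ∫⁻ ω, Z i ω ∂P = 1) :
    iIndep m (P.withDensity fun ω => ∏ i, Z i ω) := by
  rw [iIndep_iff]
  intro s A hA
  rw [withDensity_prod_biInter hm hind hZ hZ_one s hA]
  exact Finset.prod_congr rfl fun i hi =>
    (withDensity_prod_apply hm hind hZ hZ_one (hA i hi)).symm

end ProductDensities

section ChangeOfFiltration

variable {Ω : Type*} {m m' mΩ : MeasurableSpace Ω} {P : Measure Ω}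

lemma indep_sup_right [IsZeroOrProbabilityMeasure P] {m₁ m₂ m₃ : MeasurableSpace Ω} (h₁ : m₁ ≤ mΩ)
    (h₂ : m₂ ≤ mΩ) (h₃ : m₃ ≤ mΩ) (h₁₂ : Indep m₁ m₂ P) (h₁₂₃ : Indep (m₁ ⊔ m₂) m₃ P) :
    Indep m₁ (m₂ ⊔ m₃) P := by
  let p : Set (Set Ω) := image2 (· ∩ ·) {A | MeasurableSet[m₂] A} {B | MeasurableSet[m₃] B}
  have hp_pi : IsPiSystem p := by
    rintro _ ⟨A, hA, B, hB, rfl⟩ _ ⟨A', hA', B', hB', rfl⟩ -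
    exact ⟨A ∩ A', hA.inter hA', B ∩ B', hB.inter hB', inter_inter_inter_comm _ _ _ _⟩
  have hp_gen : m₂ ⊔ m₃ = MeasurableSpace.generateFrom p := by
    refine le_antisymm (sup_le (fun A hA => ?_) fun B hB => ?_) (MeasurableSpace.generateFrom_le ?_)
    · exact MeasurableSpace.measurableSet_generateFrom
        ⟨A, hA, univ, MeasurableSet.univ, inter_univ A⟩
    · exact MeasurableSpace.measurableSet_generateFrom
        ⟨univ, MeasurableSet.univ, B, hB, univ_inter B⟩
    · rintro _ ⟨A, hA, B, hB, rfl⟩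
      exact MeasurableSet.inter ((le_sup_left : m₂ ≤ m₂ ⊔ m₃) A hA)
        ((le_sup_right : m₃ ≤ m₂ ⊔ m₃) B hB)
  refine IndepSets.indep h₁ (sup_le h₂ h₃) (@MeasurableSpace.isPiSystem_measurableSet _ m₁) hp_pi
    (@MeasurableSpace.generateFrom_measurableSet _ m₁).symm hp_gen ?_
  rw [IndepSets_iff]
  rw [Indep_iff] at h₁₂ h₁₂₃
  rintro C _ hC ⟨A, hA, B, hB, rfl⟩
  have hC' : MeasurableSet[m₁ ⊔ m₂] C := (le_sup_left : m₁ ≤ m₁ ⊔ m₂) C hC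
  have hA' : MeasurableSet[m₁ ⊔ m₂] A := (le_sup_right : m₂ ≤ m₁ ⊔ m₂) A hA
  rw [← inter_assoc, h₁₂₃ _ _ (hC'.inter hA') hB, h₁₂ _ _ hC hA, h₁₂₃ _ _ hA' hB, mul_assoc]

variable {T : ℝ} {ℱ 𝒢 : Filtration (Icc (0 : ℝ) T) mΩ} {N : ℝ → Ω → ℕ} {b : ℝ → ℝ}

namespace IsPoissonProcess

lemma anti (hP : IsPoissonProcess P ℱ N b) (h𝒢 : 𝒢 ≤ ℱ)
    (hN : ∀ t : Icc (0 : ℝ) T, Measurable[𝒢 t] (N t)) : IsPoissonProcess P 𝒢 N b where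
  __ := hP
  adapted := hN
  indep s t hst := indep_of_indep_of_le_right (hP.indep s t hst) (h𝒢 s)

lemma of_le_sup [IsZeroOrProbabilityMeasure P] (hP : IsPoissonProcess P ℱ N b)
    (hm' : m' ≤ mΩ) (hℱ : ∀ t, ℱ t ≤ m) (hind : Indep m m' P)
    (h𝒢 : ∀ t, 𝒢 t ≤ ℱ t ⊔ m') (hN : ∀ t : Icc (0 : ℝ) T, Measurable[𝒢 t] (N t)) :
    IsPoissonProcess P 𝒢 N b where
  __ := hP
  adapted := hN
  indep s t hst := by
    have hD := measurable_iff_comap_le.1 (hP.measurable_sub hst le_rfl)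
    refine indep_of_indep_of_le_right (indep_sup_right (hD.trans (ℱ.le t)) (ℱ.le s) hm'
      (hP.indep s t hst) (indep_of_indep_of_le_left hind ?_)) (h𝒢 s)
    exact sup_le (hD.trans (hℱ t)) (hℱ s)

end IsPoissonProcess

end ChangeOfFiltration

section IndependentProcesses

variable {Ω : Type*} {T : ℝ}

/-- The `σ`-algebra generated by the whole path of `N` over `[0, T]`. -/
abbrev pathSigma (T : ℝ) (N : ℝ → Ω → ℕ) : MeasurableSpace Ω :=
  MeasurableSpace.comap (fun ω (t : Icc (0 : ℝ) T) => N t ω) MeasurableSpace.pi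

lemma comap_le_pathSigma (N : ℝ → Ω → ℕ) (t : Icc (0 : ℝ) T) :
    MeasurableSpace.comap (N t) inferInstance ≤ pathSigma T N := by
  rw [pathSigma, MeasurableSpace.comap_process_pi]
  exact le_iSup (fun u : Icc (0 : ℝ) T => MeasurableSpace.comap (N u) inferInstance) t

variable [mΩ : MeasurableSpace Ω]

/-- The filtration generated by a single process, as opposed to `history`. -/
noncomputable def ownHistory (N : ℝ → Ω → ℕ) (hN : ∀ t : Icc (0 : ℝ) T, Measurable (N t)) :
    Filtration (Icc (0 : ℝ) T) mΩ :=
  Filtration.natural (fun (t : Icc (0 : ℝ) T) => N t) fun t => (hN t).stronglyMeasurable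

section SingleProcess

variable {N : ℝ → Ω → ℕ}

lemma pathSigma_le (hN : ∀ t : Icc (0 : ℝ) T, Measurable (N t)) : pathSigma T N ≤ mΩ :=
  measurable_iff_comap_le.1 (measurable_pi_lambda _ hN)

lemma ownHistory_le_pathSigma (hN : ∀ t : Icc (0 : ℝ) T, Measurable (N t)) (t : Icc (0 : ℝ) T) :
    ownHistory N hN t ≤ pathSigma T N :=
  iSup₂_le fun u _ => comap_le_pathSigma N u

lemma measurable_ownHistory (hN : ∀ t : Icc (0 : ℝ) T, Measurable (N t)) (t : Icc (0 : ℝ) T) :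
    Measurable[ownHistory N hN t] (N t) :=
  (Filtration.stronglyAdapted_natural (fun t => (hN t).stronglyMeasurable) t).measurable

end SingleProcess

variable {k : ℕ} {N : Fin k → ℝ → Ω → ℕ} {hN : ∀ i, ∀ t : Icc (0 : ℝ) T, Measurable (N i t)}
  {P : Measure Ω} {β φ : Fin k → ℝ → ℝ}

lemma measurable_history (i : Fin k) (t : Icc (0 : ℝ) T) : Measurable[history N hN t] (N i t) :=
  (measurable_pi_apply i).comp (Filtration.stronglyAdapted_natural
    (fun t => (measurable_pi_lambda _ fun i => hN i t).stronglyMeasurable) t).measurable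

lemma ownHistory_le_history (i : Fin k) : ownHistory (N i) (hN i) ≤ history N hN := fun _ =>
  iSup₂_le fun u hu => measurable_iff_comap_le.1
    ((measurable_history i u).mono ((history N hN).mono hu) le_rfl)

lemma history_le_ownHistory_sup (i : Fin k) (t : Icc (0 : ℝ) T) :
    history N hN t ≤
      ownHistory (N i) (hN i) t ⊔ ⨆ j ∈ ({i}ᶜ : Set (Fin k)), pathSigma T (N j) := by
  refine iSup₂_le fun u hu => ?_
  refine (MeasurableSpace.comap_process_pi fun (j : Fin k) ω => N j u ω).le.trans
    (iSup_le fun j => ?_)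
  rcases eq_or_ne j i with rfl | hj
  · exact le_sup_of_le_left (measurable_iff_comap_le.1
      ((measurable_ownHistory (hN j) u).mono ((ownHistory (N j) (hN j)).mono hu) le_rfl))
  · exact le_sup_of_le_right (le_iSup₂_of_le j hj (comap_le_pathSigma (N j) u))

namespace AreIndepPoisson

lemma iIndep_pathSigma (h : AreIndepPoisson P N hN β) : iIndep (fun i => pathSigma T (N i)) P :=
  h.indep

lemma isPoissonProcess_ownHistory (h : AreIndepPoisson P N hN β) (i : Fin k) :
    IsPoissonProcess P (ownHistory (N i) (hN i)) (N i) (β i) :=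
  (h.poisson i).anti (ownHistory_le_history i) (measurable_ownHistory (hN i))

lemma of_ownHistory [IsZeroOrProbabilityMeasure P]
    (hP : ∀ i, IsPoissonProcess P (ownHistory (N i) (hN i)) (N i) (β i))
    (hind : iIndep (fun i => pathSigma T (N i)) P) : AreIndepPoisson P N hN β where
  poisson i := by
    have hother := indep_iSup_of_disjoint (fun j => pathSigma_le (hN j)) hind (S := {i}) (T := {i}ᶜ)
      disjoint_compl_right
    rw [iSup_singleton] at hother
    exact (hP i).of_le_sup (iSup₂_le fun j _ => pathSigma_le (hN j))
      (ownHistory_le_pathSigma (hN i)) hother (history_le_ownHistory_sup i) (measurable_history i)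
  indep := hind

lemma congr (h : AreIndepPoisson P N hN β) {γ : Fin k → ℝ → ℝ}
    (hβγ : ∀ i, EqOn (β i) (γ i) (Icc 0 T)) : AreIndepPoisson P N hN γ :=
  ⟨fun i => (h.poisson i).congr (hβγ i), h.indep⟩

theorem girsanov [IsProbabilityMeasure P] (hT : 0 ≤ T) (h : AreIndepPoisson P N hN β)
    (hφ : ∀ i, ContinuousOn (φ i) (Icc 0 T)) (hφ_nonneg : ∀ i, ∀ z ∈ Icc 0 T, 0 ≤ φ i z) :
    let Q := P.withDensity fun ω => ∏ i, segmentDensity T (β i) (φ i) (N i) 0 T ω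
    IsProbabilityMeasure Q ∧ AreIndepPoisson Q N hN fun i z => φ i z * β i z := by
  intro Q
  let start : Icc (0 : ℝ) T := ⟨0, le_rfl, hT⟩
  let final : Icc (0 : ℝ) T := ⟨T, hT, le_rfl⟩
  have hown := h.isPoissonProcess_ownHistory
  have hpath := fun i => pathSigma_le (hN i)
  have hL : ∀ i, Measurable[pathSigma T (N i)] (segmentDensity T (β i) (φ i) (N i) 0 T) := fun i =>
    ((hown i).measurable_segmentDensity (hφ i) (s := start) (t := final) hT).mono
      (ownHistory_le_pathSigma (hN i) final) le_rfl
  have hL_one : ∀ i, ∫⁻ ω, segmentDensity T (β i) (φ i) (N i) 0 T ω ∂P = 1 := fun i => by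
    simpa using (hown i).setLIntegral_segmentDensity (hφ i) (hφ_nonneg i) (s := start) (t := final)
      hT MeasurableSet.univ univ
  have hQ : IsProbabilityMeasure Q :=
    isProbabilityMeasure_withDensity_prod hpath h.iIndep_pathSigma hL hL_one
  refine ⟨hQ, of_ownHistory (fun i => (hown i).girsanov hT (hφ i) (hφ_nonneg i) fun A hA => ?_)
    (iIndep_withDensity_prod hpath h.iIndep_pathSigma hL hL_one)⟩
  exact withDensity_prod_apply hpath h.iIndep_pathSigma hL hL_one
    (ownHistory_le_pathSigma (hN i) final A hA)

end AreIndepPoisson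

end IndependentProcesses

section LikelihoodRatio

variable {Ω : Type*} [MeasurableSpace Ω] {P : Measure Ω} {k : ℕ} {T : ℝ}
  {N : Fin k → ℝ → Ω → ℕ} {hN : ∀ i, ∀ t : Icc (0 : ℝ) T, Measurable (N i t)}
  {β ν : Fin k → ℝ → ℝ}

namespace AreIndepPoisson

lemma likelihoodRatio_eq (h : AreIndepPoisson P N hN β) (hT : 0 ≤ T)
    (hβ : ∀ i, ∀ z ∈ Icc 0 T, β i z ≠ 0) :
    likelihoodRatio T N β ν = fun ω =>
      ∏ i, segmentRatio T (β i) (fun z => 1 + ν i z / β i z) (fun z => N i z ω) 0 T :=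
  funext fun ω => Finset.prod_congr rfl fun i _ =>
    localRatio_eq_segmentRatio hT ((h.poisson i).counting ω) (hβ i)

lemma measurable_likelihoodRatio (h : AreIndepPoisson P N hN β) (hT : 0 ≤ T)
    (hβ : ∀ i, ∀ z ∈ Icc 0 T, β i z ≠ 0)
    (hνβ : ∀ i, ContinuousOn (fun z => ν i z / β i z) (Icc 0 T)) :
    Measurable (likelihoodRatio T N β ν) := by
  rw [h.likelihoodRatio_eq hT hβ]
  exact Finset.measurable_fun_prod _ fun i _ =>
    ((h.poisson i).measurable_segmentRatio (continuousOn_const.add (hνβ i))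
      (s := ⟨0, le_rfl, hT⟩) (t := ⟨T, hT, le_rfl⟩) hT).mono ((history N hN).le _) le_rfl

lemma tilted_eq (h : AreIndepPoisson P N hN β) (hT : 0 ≤ T)
    (hβ : ∀ i, ∀ z ∈ Icc 0 T, β i z ≠ 0) (hνβ : ∀ i, ∀ z ∈ Icc 0 T, 0 ≤ 1 + ν i z / β i z) :
    tilted P T N β ν = P.withDensity fun ω =>
      ∏ i, segmentDensity T (β i) (fun z => 1 + ν i z / β i z) (N i) 0 T ω := by
  rw [tilted, h.likelihoodRatio_eq hT hβ]
  exact congrArg P.withDensity (funext fun ω => ENNReal.ofReal_prod_of_nonneg fun i _ =>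
    segmentRatio_nonneg ((h.poisson i).counting ω) (hνβ i) ⟨0, le_rfl, hT⟩ ⟨T, hT, le_rfl⟩)

end AreIndepPoisson

end LikelihoodRatio

theorem mainTheorem2_general {Ω : Type*} [MeasurableSpace Ω] (P₀ : Measure Ω)
    [IsProbabilityMeasure P₀] (k : ℕ) (T : ℝ) (hT : 0 ≤ T) (N : Fin k → ℝ → Ω → ℕ)
    (hN : ∀ i, ∀ t : Icc (0 : ℝ) T, Measurable (N i t)) (β ν : Fin k → ℝ → ℝ)
    (hβ : ∀ i, ∀ z ∈ Icc 0 T, 0 < β i z)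
    (hνβ : ∀ i, ContinuousOn (fun z => ν i z / β i z) (Icc 0 T))
    (hβν : ∀ i, ∀ z ∈ Icc 0 T, 0 ≤ β i z + ν i z) (hPoisson : AreIndepPoisson P₀ N hN β) :
    Measurable (likelihoodRatio T N β ν) ∧ IsProbabilityMeasure (tilted P₀ T N β ν) ∧
      tilted P₀ T N β ν ≪ P₀ ∧
      AreIndepPoisson (tilted P₀ T N β ν) N hN (fun i z => β i z + ν i z) := by
  have hβ_ne : ∀ i, ∀ z ∈ Icc 0 T, β i z ≠ 0 := fun i z hz => (hβ i z hz).ne'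
  have hφ_mul : ∀ i, EqOn (fun z => (1 + ν i z / β i z) * β i z) (fun z => β i z + ν i z)
      (Icc 0 T) := fun i z hz => by
    simp only [add_mul, one_mul, div_mul_cancel₀ _ (hβ_ne i z hz)]
  have hφ_nonneg : ∀ i, ∀ z ∈ Icc 0 T, 0 ≤ 1 + ν i z / β i z := fun i z hz =>
    nonneg_of_mul_nonneg_left ((hβν i z hz).trans_eq (hφ_mul i hz).symm) (hβ i z hz)
  have hφ : ∀ i, ContinuousOn (fun z => 1 + ν i z / β i z) (Icc 0 T) := fun i =>
    continuousOn_const.add (hνβ i)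
  obtain ⟨hQ, hQ_poisson⟩ := hPoisson.girsanov hT hφ hφ_nonneg
  rw [← hPoisson.tilted_eq hT hβ_ne hφ_nonneg] at hQ hQ_poisson
  exact ⟨hPoisson.measurable_likelihoodRatio hT hβ_ne hνβ, hQ,
    withDensity_absolutelyContinuous _ _, hQ_poisson.congr hφ_mul⟩

lemma IsAdmissible.pos {k : ℕ} {T : ℝ} {f : Fin k → ℝ → ℝ} (hf : IsAdmissible T f) (i : Fin k)
    {z : ℝ} (hz : z ∈ Icc 0 T) : 0 < f i z :=
  have ⟨_, _, hm, _, h⟩ := hf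
  hm.trans_le ((h i).2 hz).1

lemma IsAdmissible.continuousOn {k : ℕ} {T : ℝ} {f : Fin k → ℝ → ℝ} (hf : IsAdmissible T f)
    (i : Fin k) : ContinuousOn (f i) (Icc 0 T) :=
  have ⟨_, _, _, _, h⟩ := hf
  (h i).1

end PoissonDetection

theorem mainTheorem2 {Ω : Type*} [MeasurableSpace Ω] (P₀ : MeasureTheory.Measure Ω)
    [MeasureTheory.IsProbabilityMeasure P₀] (k : ℕ) (T : ℝ) (hT : 0 < T)
    (N : Fin k → ℝ → Ω → ℕ) (hN : ∀ i, ∀ t : Set.Icc (0 : ℝ) T, Measurable (N i t))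
    (β ν : Fin k → ℝ → ℝ)
    (hβ : PoissonDetection.IsAdmissible T β) (hν : PoissonDetection.IsAdmissible T ν)
    (hPoisson : PoissonDetection.AreIndepPoisson P₀ N hN β) :
    Measurable (PoissonDetection.likelihoodRatio T N β ν) ∧
    MeasureTheory.IsProbabilityMeasure (PoissonDetection.tilted P₀ T N β ν) ∧
    (PoissonDetection.tilted P₀ T N β ν).AbsolutelyContinuous P₀ ∧
    PoissonDetection.AreIndepPoisson (PoissonDetection.tilted P₀ T N β ν) N hN
      (fun i t => β i t + ν i t) :=
  PoissonDetection.mainTheorem2_general P₀ k T hT.le N hN β ν (fun i _ => hβ.pos i)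
    (fun i => (hν.continuousOn i).div (hβ.continuousOn i) fun _ hz => (hβ.pos i hz).ne')
    (fun i _ hz => (add_pos (hβ.pos i hz) (hν.pos i hz)).le) hPoisson
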